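/- Let $\Bbbk$ be a field, $K$ a finite abstract simplicial complex, $p\ge 0$ an integer, and $\mathcal M$ a smooth finite-dimensional manifold without boundary. A filter function on $K$ is a function $f:K\to\mathbb R$ with $f(\sigma)\le f(\sigma')$ whenever $\sigma\subseteq\sigma'$. Write $\mathrm{Dgm}_p(f)$ for the barcode of its persistence module $t\mapsto H_p(K^t;\Bbbk)$, where $K^t=\{\sigma\in K: f(\sigma)\le t\}$: if this module is isomorphic to $\bigoplus_{J\in\mathcal J}\mathbb I_J$ with $\mathcal J$ a finite multiset of intervals, then $\mathrm{Dgm}_p(f)=\{(\inf J,\sup J)\}_{J\in\mathcal J}\cup\Delta^\infty$, a multiset of points of $\mathbb R\times(\mathbb R\cup\{+\infty\})$ in which every point of the diagonal $\Delta=\{(b,b): b\in\mathbb R\}$ is included countably many times. Two filter functions $f,g$ are ordering equivalent, $f\sim g$, if $f(\sigma)\le f(\sigma')\iff g(\sigma)\le g(\sigma')$ for all $\sigma,\sigma'\in K$. A barcode template of $f$ in degree $p$ is a pair $(P_p,U_p)$, where $P_p$ is a finite multiset of pairs of simplices of $K$ and $U_p$ a finite multiset of simplices of $K$, such that $$\mathrm{Dgm}_p(f)=\{(f(\sigma),f(\sigma'))\}_{(\sigma,\sigma')\in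 P_p}\cup\{(f(\tau),+\infty)\}_{\tau\in U_p}\cup\Delta^\infty .$$ For $m,n\ge 0$ let $Q_{m,n}$ send $(b_1,d_1,\dots,b_m,d_m,v_1,\dots,v_n)\in\mathbb R^{2m}\times\mathbb R^n$ to the barcode $\{(b_i,d_i)\}_{i=1}^m\cup\{(v_j,+\infty)\}_{j=1}^n\cup\Delta^\infty$. A local $C^1$ lift around $\theta\in\mathcal M$ of a barcode valued map $B$ on $\mathcal M$ is a map $\tilde B$ to some $\mathbb R^{2m}\times\mathbb R^n$ which on some open neighbourhood of $\theta$ is of class $C^1$ and satisfies $B=Q_{m,n}\circ\tilde B$; the differential of $B$ at $\theta$ with respect to $\tilde B$ is then $d_{\theta,\tilde B}B:=d_\theta\tilde B: T_\theta\mathcal M\to\mathbb R^{2m}\times\mathbb R^n$. **Proposition (differential formula).** Let $F:\mathcal M\to\mathbb R^K$ be a continuous map all of whose values $F(\theta)$ are filter functions, let $F$ be of class $C^1$ on an open set $U\subseteq\mathcal M$, and put $B_p(\theta)=\mathrm{Dgm}_p(F(\theta))$. Let $\tilde{\mathcal M}$ be the set of all $\theta\in\mathcal M$ that have an open neighbourhood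 $U_\theta$ with $F(\theta')\sim F(\theta)$ for all $\theta'\in U_\theta$. Let $\theta\in U\cap\tilde{\mathcal M}$ and let $(P_p,U_p)$ be a barcode template of $F(\theta)$ in degree $p$. Then for any ordering $(\sigma_1,\sigma'_1),\dots,(\sigma_m,\sigma'_m)$ of $P_p$ and any ordering $\tau_1,\dots,\tau_n$ of $U_p$ (with multiplicities), the map $$\tilde B_p:\theta'\mapsto\big[(F(\theta')(\sigma_i),F(\theta')(\sigma'_i))_{i=1}^m,\ (F(\theta')(\tau_j))_{j=1}^n\big]\in\mathbb R^{2m}\times\mathbb R^n$$ is a local $C^1$ lift of $B_p$ around $\theta$, and the corresponding differential of $B_p$ at $\theta$ is $$d_{\theta,\tilde B_p}B_p(\cdot)=\big[(d_\theta F(\cdot)(\sigma_i),d_\theta F(\cdot)(\sigma'_i))_{i=1}^m,\ (d_\theta F(\cdot)(\tau_j))_{j=1}^n\big].$$ -/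

import Mathlib

open CategoryTheory Topology
open scoped Manifold ContDiff

universe u v

noncomputable section

/-! ### Barcodes and ordered barcodes -/

/-- The extended plane `ℝ × (ℝ ∪ {+∞})` in which the points of barcodes live. -/
abbrev ExtPlane : Type := ℝ × WithTop ℝ

open scoped Classical in
/-- The multiset union `B ∪ Δ^∞` of a finite multiset `B` of points with countably many copies of
the diagonal `Δ = {(b, b)}`, given by its multiplicity function. -/
def addDiagonal (B : Multiset ExtPlane) : ExtPlane → ℕ∞ :=
  fun x => (B.count x : ℕ∞) + if x.2 = (x.1 : WithTop ℝ) then ⊤ else 0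

/-- The set `Bar` of barcodes (persistence diagrams): all `B ∪ Δ^∞` with `B` a finite multiset,
where a multiset of points is recorded by its multiplicity function. -/
def Bar : Type := {D : ExtPlane → ℕ∞ // ∃ B : Multiset ExtPlane, D = addDiagonal B}

/-- The barcode `B ∪ Δ^∞`. -/
def Bar.mk (B : Multiset ExtPlane) : Bar := ⟨addDiagonal B, B, rfl⟩

/-- The Euclidean space `ℝ^{2m} × ℝ^n` of ordered barcodes. The coordinates `Sum.inl (i, 0)`,
`Sum.inl (i, 1)` and `Sum.inr j` are `b_i`, `d_i` and `v_j`. -/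
abbrev OrderedBarcode (m n : ℕ) : Type := EuclideanSpace ℝ (Fin m × Fin 2 ⊕ Fin n)

/-- The quotient map `Q_{m,n}`, sending `(b_1, d_1, …, b_m, d_m, v_1, …, v_n)` to
`{(b_i, d_i)} ∪ {(v_j, +∞)} ∪ Δ^∞`. -/
def barQuotient (m n : ℕ) (x : OrderedBarcode m n) : Bar :=
  Bar.mk
    ((Finset.univ : Finset (Fin m)).val.map
        (fun i => (x (Sum.inl (i, 0)), (x (Sum.inl (i, 1)) : WithTop ℝ))) +
      (Finset.univ : Finset (Fin n)).val.map
        (fun j => (x (Sum.inr j), (⊤ : WithTop ℝ))))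

/-! ### Persistence modules and their barcodes -/

/-- Persistence modules over the field `k`: functors from `(ℝ, ≤)` to `k`-vector spaces. -/
abbrev PersistenceModule (k : Type v) [Field k] : Type _ := ℝ ⥤ ModuleCat.{max u v} k

/-- The space of an interval module at `t`: a copy of `k` if `t ∈ J`, and zero otherwise. -/
def intervalSpace (k : Type v) [Field k] (J : Set ℝ) (t : ℝ) : Submodule k (ULift.{u} k) where
  carrier := {x | t ∉ J → x = 0}
  add_mem' := fun hx hy ht => by rw [hx ht, hy ht, add_zero]
  zero_mem' := fun _ => rfl
  smul_mem' := fun c _ hx ht => by rw [hx ht, smul_zero]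

open scoped Classical in
/-- The structure map of an interval module: the identity of `k` if both parameters lie in the
interval, and zero otherwise (an element at a parameter outside `J` is zero anyway). -/
def intervalMap (k : Type v) [Field k] (J : Set ℝ) (s t : ℝ) :
    intervalSpace.{u} k J s →ₗ[k] intervalSpace.{u} k J t where
  toFun x := ⟨if t ∈ J then x.1 else 0, fun ht => if_neg ht⟩
  map_add' x y := by
    apply Subtype.ext
    by_cases h : t ∈ J <;> simp [h]
  map_smul' c x := by
    apply Subtype.ext
    by_cases h : t ∈ J <;> simp [h]

/-- The interval module `𝕀_J` of an interval `J` of `ℝ`. -/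
def intervalModule (k : Type v) [Field k] (J : Set ℝ) (hJ : J.OrdConnected) :
    PersistenceModule.{u} k where
  obj t := ModuleCat.of k (intervalSpace.{u} k J t)
  map {s t} _ := ModuleCat.ofHom (intervalMap.{u} k J s t)
  map_id t := by
    refine ModuleCat.hom_ext (LinearMap.ext fun x => Subtype.ext ?_)
    by_cases h : t ∈ J
    · simp [intervalMap, h]
    · simpa [intervalMap, h] using (x.2 h).symm
  map_comp {r s t} f g := by
    refine ModuleCat.hom_ext (LinearMap.ext fun x => Subtype.ext ?_)
    by_cases ht : t ∈ J
    · by_cases hs : s ∈ J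
      · simp [intervalMap, ht, hs]
      · have hr : r ∉ J := fun hr => hs (hJ.out hr ht ⟨f.le, g.le⟩)
        simpa [intervalMap, ht, hs] using x.2 hr
    · simp [intervalMap, ht]

open scoped Classical in
/-- The point `(inf J, sup J)` of the extended plane, for `J` nonempty and bounded below. -/
def intervalPoint (J : Set ℝ) : ExtPlane :=
  (sInf J, if BddAbove J then ((sSup J : ℝ) : WithTop ℝ) else ⊤)

/-- `D` is a barcode of `𝕍`: the module `𝕍` is isomorphic to a finite direct sum `⨁ i, 𝕀_{J i}` of
interval modules, and `D = {(inf J i, sup J i)} ∪ Δ^∞`. The intervals are nonempty, and bounded below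
because the points of a barcode have a real first coordinate. -/
def HasBarcode (k : Type v) [Field k] (W : PersistenceModule.{u} k) (D : Bar) : Prop :=
  ∃ (N : ℕ) (J : Fin N → Set ℝ) (hJ : ∀ i, (J i).OrdConnected),
    (∀ i, (J i).Nonempty) ∧ (∀ i, BddBelow (J i)) ∧
    Nonempty (W ≅ ∐ fun i => intervalModule.{u} k (J i) (hJ i)) ∧
    D = Bar.mk ((Finset.univ : Finset (Fin N)).val.map fun i => intervalPoint (J i))

open scoped Classical in
/-- The barcode of a persistence module of finite type. By the uniqueness of interval decompositions
it does not depend on the choice. A module without a barcode gets the value `Δ^∞`, which is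
not relevant for the sublevel set persistent homology of a filter function on a finite complex:
such a module always has a barcode. -/
def barcodeOf (k : Type v) [Field k] (W : PersistenceModule.{u} k) : Bar :=
  if h : ∃ D, HasBarcode k W D then h.choose else Bar.mk 0

/-! ### Filter functions on a finite simplicial complex and their persistent homology

A finite abstract simplicial complex is a `PreAbstractSimplicialComplex V` on a finite type `V`
(not every element of `V` has to be a vertex). -/

instance simplicesFintype {V : Type u} [Fintype V] (K : PreAbstractSimplicialComplex V) :
    Fintype K :=
  Fintype.ofFinite K

/-- `f : K → ℝ` is a filter function: it is monotone with respect to inclusions of faces. -/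
def IsFilterFunction {V : Type u} {K : PreAbstractSimplicialComplex V} (f : K → ℝ) : Prop :=
  ∀ σ σ' : K, (σ : Finset V) ⊆ σ' → f σ ≤ f σ'

/-- The sublevel complex `K^t = {σ ∈ K | f σ ≤ t}`. -/
def sublevelComplex {V : Type u} {K : PreAbstractSimplicialComplex V} (f : K → ℝ)
    (hf : IsFilterFunction f) (t : ℝ) : PreAbstractSimplicialComplex V where
  faces := {σ | ∃ h : σ ∈ K, f ⟨σ, h⟩ ≤ t}
  isRelLowerSet_faces := by
    rintro σ ⟨hσ, hσt⟩
    refine ⟨(K.isRelLowerSet_faces hσ).1, fun ρ hρσ hρ => ?_⟩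
    have hρK : ρ ∈ K := (K.isRelLowerSet_faces hσ).2 hρσ hρ
    exact ⟨hρK, (hf ⟨ρ, hρK⟩ ⟨σ, hσ⟩ hρσ).trans hσt⟩

theorem sublevelComplex_mono {V : Type u} {K : PreAbstractSimplicialComplex V} (f : K → ℝ)
    (hf : IsFilterFunction f) : Monotone (sublevelComplex f hf) :=
  fun _ _ hst _ hσ => ⟨hσ.1, hσ.2.trans hst⟩

open scoped Classical in
/-- The geometric realization `|L|` of a complex on a finite vertex type: the points of the standard
simplex (barycentric coordinates on `V`) whose support is a simplex of `L`. -/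
def realization {V : Type u} [Fintype V] (L : PreAbstractSimplicialComplex V) : Set (V → ℝ) :=
  {x | x ∈ stdSimplex ℝ V ∧ (Finset.univ.filter fun w => x w ≠ 0) ∈ L}

theorem realization_mono {V : Type u} [Fintype V] {L L' : PreAbstractSimplicialComplex V}
    (h : L ≤ L') : realization L ⊆ realization L' :=
  fun _ hx => ⟨hx.1, h hx.2⟩

/-- Geometric realization, as a functor from the poset of complexes on `V` to spaces; the maps
are the inclusions. -/
def realizationFunctor (V : Type u) [Fintype V] : PreAbstractSimplicialComplex V ⥤ TopCat.{u} where
  obj L := TopCat.of (realization L)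
  map {_ _} h := TopCat.ofHom
    ⟨Set.inclusion (realization_mono h.le), continuous_inclusion (realization_mono h.le)⟩
  map_id _ := rfl
  map_comp _ _ := rfl

/-- Singular homology in degree `p` with coefficients in the field `k`. -/
def singularHomologyOver (k : Type v) [Field k] (p : ℕ) : TopCat.{u} ⥤ ModuleCat.{max u v} k :=
  (AlgebraicTopology.singularHomologyFunctor.{u} (ModuleCat.{max u v} k) p).obj
    (ModuleCat.of k (ULift.{u} k))

/-- The sublevel set persistent homology `𝐇_p(f)` of a filter function: the spaces `H_p(K^t)`
with the maps induced by the inclusions `K^s ⊆ K^t`. -/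
def persistentHomology (k : Type v) [Field k] (p : ℕ) {V : Type u} [Fintype V]
    {K : PreAbstractSimplicialComplex V} (f : K → ℝ) (hf : IsFilterFunction f) :
    PersistenceModule.{u} k :=
  (sublevelComplex_mono f hf).functor ⋙ realizationFunctor V ⋙ singularHomologyOver k p

/-- The barcode `Dgm_p(f)` of a filter function in degree `p`. -/
def Dgm (k : Type v) [Field k] (p : ℕ) {V : Type u} [Fintype V]
    {K : PreAbstractSimplicialComplex V} (f : K → ℝ) (hf : IsFilterFunction f) : Bar :=
  barcodeOf.{u} k (persistentHomology k p f hf)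

/-- Ordering equivalence `f ∼ g`: both functions induce the same pre-order on `K`. -/
def OrderingEquivalent {V : Type u} {K : PreAbstractSimplicialComplex V} (f g : K → ℝ) : Prop :=
  ∀ σ σ' : K, f σ ≤ f σ' ↔ g σ ≤ g σ'

/-- `(P, T)` is a barcode template of `f` in degree `p`:
`Dgm_p(f) = {(f σ, f σ')}_{(σ, σ') ∈ P} ∪ {(f τ, +∞)}_{τ ∈ T} ∪ Δ^∞`. -/
def IsBarcodeTemplate (k : Type v) [Field k] (p : ℕ) {V : Type u} [Fintype V]
    {K : PreAbstractSimplicialComplex V} (f : K → ℝ) (hf : IsFilterFunction f)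
    (P : Multiset (K × K)) (T : Multiset K) : Prop :=
  Dgm k p f hf = Bar.mk (P.map (fun q => (f q.1, (f q.2 : WithTop ℝ))) +
    T.map (fun τ => (f τ, (⊤ : WithTop ℝ))))

/-- The vector `[(f σ_i, f σ'_i)_i, (f τ_j)_j]` of `ℝ^{2m} × ℝ^n`. -/
def readSimplices {V : Type u} {K : PreAbstractSimplicialComplex V} {m n : ℕ}
    (σ σ' : Fin m → K) (τ : Fin n → K) (f : K → ℝ) : OrderedBarcode m n :=
  WithLp.toLp 2 (Sum.elim (fun q => if q.2 = 0 then f (σ q.1) else f (σ' q.1)) fun j => f (τ j))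

/-! ### Barcode valued maps on a manifold -/

section Manifold

variable {E : Type*} [NormedAddCommGroup E] [NormedSpace ℝ E] {H : Type*} [TopologicalSpace H]
  (I : ModelWithCorners ℝ E H) {M : Type*} [TopologicalSpace M] [ChartedSpace H M]

/-- `Btilde` is a local `C^r` lift of `B : M → Bar` around `x`: on some open neighborhood of `x` it is
of class `C^r` and satisfies `B = Q_{m,n} ∘ Btilde`. -/
def IsLocalLift (r : WithTop ℕ∞) (B : M → Bar) (x : M) {m n : ℕ}
    (Btilde : M → OrderedBarcode m n) : Prop :=
  ∃ O : Set M, IsOpen O ∧ x ∈ O ∧ ContMDiffOn I 𝓘(ℝ, OrderedBarcode m n) r Btilde O ∧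
    ∀ x' ∈ O, B x' = barQuotient m n (Btilde x')

/-- The differential `d_{x, Btilde} B : T_x M → ℝ^{2m} × ℝ^n` of `B` at `x` with respect to a `C^1`
local lift `Btilde`: the differential of `Btilde` at `x`. -/
def barcodeDifferential {B : M → Bar} {x : M} {m n : ℕ} {Btilde : M → OrderedBarcode m n}
    (_ : IsLocalLift I 1 B x Btilde) : TangentSpace I x →L[ℝ] OrderedBarcode m n :=
  mfderiv I 𝓘(ℝ, OrderedBarcode m n) Btilde x

/-- The differential `d_θ F : T_θ M → ℝ^K`, with the tangent space of `ℝ^K` identified with `ℝ^K`. -/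
def parametrizationDifferential {V : Type u} [Fintype V] {K : PreAbstractSimplicialComplex V}
    (F : M → EuclideanSpace ℝ K) (θ : M) : TangentSpace I θ →L[ℝ] EuclideanSpace ℝ K :=
  mfderiv I 𝓘(ℝ, EuclideanSpace ℝ K) F θ

end Manifold

/-- The barcode valued map `B_p : θ ↦ Dgm_p(F θ)` of a parametrization `F` by filter functions. -/
def barcodeMap (k : Type v) [Field k] (p : ℕ) {V : Type u} [Fintype V]
    {K : PreAbstractSimplicialComplex V} {M : Type*} (F : M → EuclideanSpace ℝ K)
    (hF : ∀ θ, IsFilterFunction (F θ)) (θ : M) : Bar :=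
  Dgm k p (F θ) (hF θ)

/-- The set of parameters around which `F` is locally constant up to ordering equivalence. -/
def orderStableSet {V : Type u} [Fintype V] {K : PreAbstractSimplicialComplex V} {M : Type*}
    [TopologicalSpace M] (F : M → EuclideanSpace ℝ K) : Set M :=
  {θ | ∃ O : Set M, IsOpen O ∧ θ ∈ O ∧ ∀ θ' ∈ O, OrderingEquivalent (F θ') (F θ)}

end

noncomputable section

/-! ### Extending strictly monotone maps on finite sets to order automorphisms of `ℝ` -/

/-! Near `θ` the functions `F θ'` all order the simplices as `F θ` does. Two ordering equivalent
functions `f`, `g` satisfy `g = ψ ∘ f` for an order automorphism `ψ` of `ℝ`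
(`OrderingEquivalent.exists_orderIso`). The sublevel complex of `g` at `t` is then that of `f` at
`ψ⁻¹ t`, so the persistence module of `g` is a reparametrization of that of `f`: intervals `J`
become `ψ(J)` and barcode points move by `ψ` (`HasBarcode.reparametrize`). As `ψ (f σ) = g σ`, a
template of `f` is one of `g`. Hence near `θ` the barcode is read off the same simplices, that is,
through a fixed linear map applied to `F`, and the chain rule gives the differential.

Since `barcodeOf` chooses a decomposition, this needs barcodes to be unique (`HasBarcode.unique`).
The rank of the structure map from `s` to `t` counts the intervals containing both, and
inclusion-exclusion over nearby ranks recovers the multiplicity of every off-diagonal point. -/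

theorem exists_orderIso_fix_le (c y z : ℝ) (hy : c < y) (hz : c < z) :
    ∃ χ : ℝ ≃o ℝ, (∀ x ≤ c, χ x = x) ∧ χ y = z := by
  set l : ℝ := (z - c) / (y - c) with hl
  have hl0 : 0 < l := div_pos (sub_pos.2 hz) (sub_pos.2 hy)
  let h : ℝ → ℝ := fun x => if x ≤ c then x else c + l * (x - c)
  have hmono : StrictMono h := by
    intro a b hab
    by_cases hb : b ≤ c
    · simpa [h, hb, hab.le.trans hb] using hab
    · by_cases ha : a ≤ c
      · have : 0 < l * (b - c) := mul_pos hl0 (sub_pos.2 (not_le.1 hb))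
        simp only [h, ha, hb, if_true, if_false]
        linarith
      · simp only [h, ha, hb, if_false]
        have := mul_lt_mul_of_pos_left hab hl0
        linarith
  have hsurj : Function.Surjective h := by
    intro w
    by_cases hw : w ≤ c
    · exact ⟨w, by simp [h, hw]⟩
    · refine ⟨c + (w - c) / l, ?_⟩
      have : 0 < (w - c) / l := div_pos (sub_pos.2 (not_le.1 hw)) hl0
      have h1 : ¬ c + (w - c) / l ≤ c := by linarith
      simp only [h, h1, if_false]
      field_simp
      ring
  refine ⟨hmono.orderIsoOfSurjective h hsurj, fun x hx => by simp [h, hx], ?_⟩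
  have : y - c ≠ 0 := (sub_pos.2 hy).ne'
  simp only [StrictMono.coe_orderIsoOfSurjective, h, not_le.2 hy, if_false, hl]
  field_simp
  ring

theorem exists_orderIso_extend (S : Finset ℝ) (h : ℝ → ℝ) (hS : StrictMonoOn h S) :
    ∃ ψ : ℝ ≃o ℝ, ∀ x ∈ S, ψ x = h x := by
  induction S using Finset.induction_on_max with
  | empty => exact ⟨OrderIso.refl ℝ, by simp⟩
  | insert a S hlt ih =>
    obtain ⟨ψ, hψ⟩ := ih (hS.mono (by simp))
    -- The new maximum `a` is corrected by an automorphism that is the identity up to `c`. Choosing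
    -- `c` above the old values and below `ψ a` and `h a` leaves those values untouched.
    obtain ⟨c, hc, hca, hcb⟩ : ∃ c, (∀ x ∈ S, ψ x ≤ c) ∧ c < ψ a ∧ c < h a := by
      rcases S.eq_empty_or_nonempty with rfl | hne
      · exact ⟨min (ψ a) (h a) - 1, by simp, by linarith [min_le_left (ψ a) (h a)],
          by linarith [min_le_right (ψ a) (h a)]⟩
      · have hm := S.max'_mem hne
        refine ⟨ψ (S.max' hne), fun x hx => ψ.monotone (S.le_max' x hx),
          ψ.strictMono (hlt _ hm), ?_⟩
        rw [hψ _ hm]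
        exact hS (by simp [hm]) (by simp) (hlt _ hm)
    obtain ⟨χ, hχ, hχa⟩ := exists_orderIso_fix_le c (ψ a) (h a) hca hcb
    refine ⟨ψ.trans χ, fun x hx => ?_⟩
    rcases Finset.mem_insert.1 hx with rfl | hx
    · simpa using hχa
    · rw [OrderIso.trans_apply, hχ _ (hc x hx), hψ x hx]

/-- Equal values of `f` force equal values of `g`, so `g` factors through `f` by a strictly
increasing map on the finite image of `f`. The default `0` of `Function.extend` off that image plays
no role. -/
theorem OrderingEquivalent.exists_orderIso {V : Type u} [Fintype V]
    {K : PreAbstractSimplicialComplex V} {f g : K → ℝ} (hfg : OrderingEquivalent f g) :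
    ∃ ψ : ℝ ≃o ℝ, ∀ σ, ψ (f σ) = g σ := by
  classical
  have hext : ∀ σ, Function.extend f g (fun _ => 0) (f σ) = g σ := by
    refine Function.FactorsThrough.extend_apply (fun a b hab => ?_) _
    exact le_antisymm ((hfg a b).1 hab.le) ((hfg b a).1 hab.ge)
  obtain ⟨ψ, hψ⟩ := exists_orderIso_extend (Finset.univ.image f) (Function.extend f g (fun _ => 0)) (by
    intro x hx y hy hxy
    obtain ⟨σ, -, rfl⟩ := Finset.mem_image.1 (Finset.mem_coe.1 hx)
    obtain ⟨τ, -, rfl⟩ := Finset.mem_image.1 (Finset.mem_coe.1 hy)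
    rw [hext, hext]
    exact lt_of_not_ge fun hle => hxy.not_ge ((hfg τ σ).2 hle))
  exact ⟨ψ, fun σ => by rw [hψ _ (by simp), hext]⟩

/-! ### Finite direct sums of interval modules -/

variable (k : Type v) [Field k]

/-- The space at `t` of a finite direct sum of interval modules. -/
def intervalSumSpace {N : ℕ} (J : Fin N → Set ℝ) (t : ℝ) :
    Submodule k (Fin N → ULift.{u} k) where
  carrier := {x | ∀ i, t ∉ J i → x i = 0}
  add_mem' := fun hx hy i ht => by rw [Pi.add_apply, hx i ht, hy i ht, add_zero]
  zero_mem' := fun _ _ => rfl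
  smul_mem' := fun c _ hx i ht => by rw [Pi.smul_apply, hx i ht, smul_zero]

open scoped Classical in
/-- The structure map of a finite direct sum of interval modules. -/
def intervalSumMap {N : ℕ} (J : Fin N → Set ℝ) (s t : ℝ) :
    intervalSumSpace.{u} k J s →ₗ[k] intervalSumSpace.{u} k J t where
  toFun x := ⟨fun i => if t ∈ J i then x.1 i else 0, fun _ ht => if_neg ht⟩
  map_add' x y := by
    refine Subtype.ext (funext fun i => ?_)
    by_cases h : t ∈ J i <;> simp [h]
  map_smul' c x := by
    refine Subtype.ext (funext fun i => ?_)
    by_cases h : t ∈ J i <;> simp [h]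

/-- An explicit model of the direct sum of finitely many interval modules. -/
def intervalSum {N : ℕ} (J : Fin N → Set ℝ) (hJ : ∀ i, (J i).OrdConnected) :
    PersistenceModule.{u} k where
  obj t := ModuleCat.of k (intervalSumSpace.{u} k J t)
  map {s t} _ := ModuleCat.ofHom (intervalSumMap.{u} k J s t)
  map_id t := by
    refine ModuleCat.hom_ext (LinearMap.ext fun x => Subtype.ext (funext fun i => ?_))
    by_cases h : t ∈ J i
    · simp [intervalSumMap, h]
    · simpa [intervalSumMap, h] using (x.2 i h).symm
  map_comp {r s t} f g := by
    refine ModuleCat.hom_ext (LinearMap.ext fun x => Subtype.ext (funext fun i => ?_))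
    by_cases ht : t ∈ J i
    · by_cases hs : s ∈ J i
      · simp [intervalSumMap, ht, hs]
      · have hr : r ∉ J i := fun hr => hs ((hJ i).out hr ht ⟨f.le, g.le⟩)
        simpa [intervalSumMap, ht, hs] using x.2 i hr
    · simp [intervalSumMap, ht]

/-- The inclusion of a summand into `intervalSumSpace`. -/
def intervalSumSingle {N : ℕ} (J : Fin N → Set ℝ) (i : Fin N) (t : ℝ) :
    intervalSpace.{u} k (J i) t →ₗ[k] intervalSumSpace.{u} k J t :=
  ((LinearMap.single k (fun _ : Fin N => ULift.{u} k) i).comp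
    (intervalSpace.{u} k (J i) t).subtype).codRestrict _ (by
      intro x j hj
      rcases eq_or_ne j i with rfl | hji
      · simpa using x.2 hj
      · simp [hji])

/-- The projection of `intervalSumSpace` onto a summand. -/
def intervalSumProj {N : ℕ} (J : Fin N → Set ℝ) (i : Fin N) (t : ℝ) :
    intervalSumSpace.{u} k J t →ₗ[k] intervalSpace.{u} k (J i) t :=
  ((LinearMap.proj i).comp (intervalSumSpace.{u} k J t).subtype).codRestrict _
    fun x ht => x.2 i ht

theorem sum_intervalSumSingle_proj {N : ℕ} (J : Fin N → Set ℝ) (t : ℝ)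
    (x : intervalSumSpace.{u} k J t) :
    ∑ i, intervalSumSingle.{u} k J i t (intervalSumProj.{u} k J i t x) = x := by
  refine Subtype.ext ?_
  rw [AddSubmonoidClass.coe_finsetSum]
  exact LinearMap.sum_single_apply (φ := fun _ : Fin N => ULift.{u} k) x.1

theorem intervalSumProj_single_self {N : ℕ} (J : Fin N → Set ℝ) (i : Fin N) (t : ℝ)
    (x : intervalSpace.{u} k (J i) t) :
    intervalSumProj.{u} k J i t (intervalSumSingle.{u} k J i t x) = x :=
  Subtype.ext (Pi.single_eq_same (M := fun _ : Fin N => ULift.{u} k) i x.1)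

theorem intervalSumProj_single_of_ne {N : ℕ} (J : Fin N → Set ℝ) {i j : Fin N} (hij : j ≠ i)
    (t : ℝ) (x : intervalSpace.{u} k (J i) t) :
    intervalSumProj.{u} k J j t (intervalSumSingle.{u} k J i t x) = 0 :=
  Subtype.ext (Pi.single_eq_of_ne (M := fun _ : Fin N => ULift.{u} k) hij x.1)

open scoped Classical in
theorem intervalSumMap_single {N : ℕ} (J : Fin N → Set ℝ) (i : Fin N) (s t : ℝ)
    (x : intervalSpace.{u} k (J i) s) :
    intervalSumMap.{u} k J s t (intervalSumSingle.{u} k J i s x) =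
      intervalSumSingle.{u} k J i t (intervalMap.{u} k (J i) s t x) := by
  refine Subtype.ext (funext fun j => ?_)
  change (if t ∈ J j then (Pi.single i x.1 : Fin N → ULift.{u} k) j else 0) =
    (Pi.single i (if t ∈ J i then x.1 else 0) : Fin N → ULift.{u} k) j
  rcases eq_or_ne j i with rfl | hji
  · simp
  · simp [hji]

/-- The cofan of the summands of `intervalSum`. -/
def intervalSumCofan {N : ℕ} (J : Fin N → Set ℝ) (hJ : ∀ i, (J i).OrdConnected) :
    Limits.Cofan fun i => intervalModule.{u} k (J i) (hJ i) :=
  Limits.Cofan.mk (intervalSum.{u} k J hJ) fun i =>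
    { app := fun t => ModuleCat.ofHom (intervalSumSingle.{u} k J i t)
      naturality := fun s t _ => ModuleCat.hom_ext (LinearMap.ext fun x =>
        (intervalSumMap_single k J i s t x).symm) }

/-- The component at `t` of a map out of an interval module, as a linear map. -/
def intervalModuleApp {J : Set ℝ} {hJ : J.OrdConnected} {W : PersistenceModule.{u} k}
    (φ : intervalModule.{u} k J hJ ⟶ W) (t : ℝ) : intervalSpace.{u} k J t →ₗ[k] W.obj t :=
  (φ.app t).hom

theorem intervalModuleApp_map {J : Set ℝ} {hJ : J.OrdConnected} {W : PersistenceModule.{u} k}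
    (φ : intervalModule.{u} k J hJ ⟶ W) {s t : ℝ} (f : s ⟶ t) (x : intervalSpace.{u} k J s) :
    intervalModuleApp k φ t (intervalMap.{u} k J s t x) =
      (W.map f).hom (intervalModuleApp k φ s x) :=
  LinearMap.congr_fun (ModuleCat.hom_ext_iff.1 (φ.naturality f)) x

/-- The linear map out of `intervalSumSpace` induced by maps out of the summands. -/
def intervalSumDescApp {N : ℕ} (J : Fin N → Set ℝ) (hJ : ∀ i, (J i).OrdConnected)
    {W : PersistenceModule.{u} k} (φ : ∀ i, intervalModule.{u} k (J i) (hJ i) ⟶ W) (t : ℝ) :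
    intervalSumSpace.{u} k J t →ₗ[k] W.obj t :=
  ∑ i, intervalModuleApp k (φ i) t ∘ₗ intervalSumProj.{u} k J i t

theorem intervalSumDescApp_apply {N : ℕ} (J : Fin N → Set ℝ) (hJ : ∀ i, (J i).OrdConnected)
    {W : PersistenceModule.{u} k} (φ : ∀ i, intervalModule.{u} k (J i) (hJ i) ⟶ W) (t : ℝ)
    (x : intervalSumSpace.{u} k J t) :
    intervalSumDescApp k J hJ φ t x =
      ∑ i, intervalModuleApp k (φ i) t (intervalSumProj.{u} k J i t x) := by
  simp [intervalSumDescApp]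

theorem intervalSumDescApp_map {N : ℕ} (J : Fin N → Set ℝ) (hJ : ∀ i, (J i).OrdConnected)
    {W : PersistenceModule.{u} k} (φ : ∀ i, intervalModule.{u} k (J i) (hJ i) ⟶ W) {s t : ℝ}
    (f : s ⟶ t) (x : intervalSumSpace.{u} k J s) :
    intervalSumDescApp k J hJ φ t (intervalSumMap.{u} k J s t x) =
      (W.map f).hom (intervalSumDescApp k J hJ φ s x) := by
  rw [intervalSumDescApp_apply, intervalSumDescApp_apply, map_sum]
  exact Finset.sum_congr rfl fun i _ =>
    intervalModuleApp_map k (φ i) f (intervalSumProj.{u} k J i s x)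

theorem intervalSumDescApp_single {N : ℕ} (J : Fin N → Set ℝ) (hJ : ∀ i, (J i).OrdConnected)
    {W : PersistenceModule.{u} k} (φ : ∀ i, intervalModule.{u} k (J i) (hJ i) ⟶ W) (t : ℝ)
    (i : Fin N) (x : intervalSpace.{u} k (J i) t) :
    intervalSumDescApp k J hJ φ t (intervalSumSingle.{u} k J i t x) =
      intervalModuleApp k (φ i) t x := by
  rw [intervalSumDescApp_apply, Finset.sum_eq_single i]
  · rw [intervalSumProj_single_self]
  · intro j _ hj
    rw [intervalSumProj_single_of_ne k J hj, map_zero]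
  · simp

theorem eq_intervalSumDescApp {N : ℕ} (J : Fin N → Set ℝ) (hJ : ∀ i, (J i).OrdConnected)
    {W : PersistenceModule.{u} k} (φ : ∀ i, intervalModule.{u} k (J i) (hJ i) ⟶ W) (t : ℝ)
    (m : intervalSumSpace.{u} k J t →ₗ[k] W.obj t)
    (hm : ∀ i x, m (intervalSumSingle.{u} k J i t x) = intervalModuleApp k (φ i) t x) :
    m = intervalSumDescApp k J hJ φ t := by
  ext1 x
  conv_lhs => rw [← sum_intervalSumSingle_proj k J t x]
  rw [map_sum, intervalSumDescApp_apply]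
  exact Finset.sum_congr rfl fun i _ => hm i _

/-- `intervalSum` is the coproduct of its summands. -/
def isColimitIntervalSumCofan {N : ℕ} (J : Fin N → Set ℝ) (hJ : ∀ i, (J i).OrdConnected) :
    Limits.IsColimit (intervalSumCofan.{u} k J hJ) :=
  Limits.Cofan.IsColimit.mk _
    (fun c =>
      { app := fun t => ModuleCat.ofHom (intervalSumDescApp k J hJ c.inj t)
        naturality := fun _ _ f => ModuleCat.hom_ext (LinearMap.ext fun x =>
          intervalSumDescApp_map k J hJ c.inj f x) })
    (fun c i => NatTrans.ext (funext fun t => ModuleCat.hom_ext (LinearMap.ext fun x =>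
      intervalSumDescApp_single k J hJ c.inj t i x)))
    (fun c m hm => NatTrans.ext (funext fun t => ModuleCat.hom_ext
      (eq_intervalSumDescApp k J hJ c.inj t (m.app t).hom fun i x => by rw [← hm i]; rfl)))

/-- The abstract direct sum of interval modules is isomorphic to the explicit one. -/
def sigmaIsoIntervalSum {N : ℕ} (J : Fin N → Set ℝ) (hJ : ∀ i, (J i).OrdConnected) :
    (∐ fun i => intervalModule.{u} k (J i) (hJ i)) ≅ intervalSum.{u} k J hJ :=
  (Limits.coproductIsCoproduct _).coconePointUniqueUpToIso (isColimitIntervalSumCofan.{u} k J hJ)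

/-! ### The rank invariant -/

variable {k}

/-- The rank of the structure map of a persistence module from `s` to `t`. -/
def persistentRank (W : PersistenceModule.{u} k) {s t : ℝ} (hst : s ≤ t) : ℕ :=
  Module.finrank k (LinearMap.range (W.map (homOfLE hst)).hom)

theorem persistentRank_congr {W W' : PersistenceModule.{u} k} (e : W ≅ W') {s t : ℝ}
    (hst : s ≤ t) : persistentRank W hst = persistentRank W' hst := by
  let es := (e.app s).toLinearEquiv
  let et := (e.app t).toLinearEquiv
  have h : et.toLinearMap ∘ₗ (W.map (homOfLE hst)).hom =
      (W'.map (homOfLE hst)).hom ∘ₗ es.toLinearMap :=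
    ModuleCat.hom_ext_iff.1 (e.hom.naturality (homOfLE hst))
  have h2 : LinearMap.range (W'.map (homOfLE hst)).hom =
      (LinearMap.range (W.map (homOfLE hst)).hom).map et.toLinearMap := by
    rw [← LinearMap.range_comp, h, LinearMap.range_comp_of_range_eq_top _ (LinearEquiv.range es)]
  rw [persistentRank, persistentRank, h2]
  exact (LinearEquiv.finrank_map_eq et _).symm

variable (k)

open scoped Classical in
-- The structure map is the identity on the coordinates whose interval contains both `s` and `t`,
-- and zero on the others. `φ` includes the former coordinates by zero.
theorem persistentRank_intervalSum {N : ℕ} (J : Fin N → Set ℝ) (hJ : ∀ i, (J i).OrdConnected)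
    {s t : ℝ} (hst : s ≤ t) :
    persistentRank (intervalSum.{u} k J hJ) hst =
      ∑ i, if s ∈ J i ∧ t ∈ J i then 1 else 0 := by
  let A := {i // s ∈ J i ∧ t ∈ J i}
  let φ : (A → ULift.{u} k) →ₗ[k] intervalSumSpace.{u} k J s :=
    { toFun := fun y => ⟨fun i => if h : s ∈ J i ∧ t ∈ J i then y ⟨i, h⟩ else 0,
        fun i hi => dif_neg fun h => hi h.1⟩
      map_add' := fun y z => by
        refine Subtype.ext (funext fun i => ?_)
        by_cases h : s ∈ J i ∧ t ∈ J i <;> simp [h]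
      map_smul' := fun c y => by
        refine Subtype.ext (funext fun i => ?_)
        by_cases h : s ∈ J i ∧ t ∈ J i <;> simp [h] }
  have hinj : Function.Injective (intervalSumMap.{u} k J s t ∘ₗ φ) := by
    intro y z hyz
    funext i
    have := congrFun (congrArg Subtype.val hyz) i.1
    simpa [intervalSumMap, φ, i.2.1, i.2.2] using this
  have hrange : LinearMap.range (intervalSumMap.{u} k J s t) =
      LinearMap.range (intervalSumMap.{u} k J s t ∘ₗ φ) := by
    refine le_antisymm ?_ (LinearMap.range_comp_le_range _ _)
    rintro _ ⟨x, rfl⟩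
    refine ⟨fun i => x.1 i.1, Subtype.ext (funext fun i => ?_)⟩
    by_cases ht : t ∈ J i
    · by_cases hs : s ∈ J i
      · simp [intervalSumMap, φ, hs, ht]
      · simpa [intervalSumMap, φ, hs, ht] using (x.2 i hs).symm
    · simp [intervalSumMap, ht]
  change Module.finrank k (LinearMap.range (intervalSumMap.{u} k J s t)) = _
  rw [hrange, LinearMap.finrank_range_of_inj hinj, Module.finrank_pi_fintype]
  have h1 : Module.finrank k (ULift.{u} k) = 1 := by
    rw [LinearEquiv.finrank_eq ULift.moduleEquiv, Module.finrank_self]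
  simp [h1, A, Fintype.card_subtype]

/-! ### Reading off the endpoints of intervals from the rank invariant -/

theorem mem_of_sInf_lt_of_lt_sSup {J : Set ℝ} (hJ : J.OrdConnected) (hne : J.Nonempty) {x : ℝ}
    (h1 : sInf J < x) (h2 : x < sSup J) : x ∈ J := by
  obtain ⟨y, hy, hyx⟩ := exists_lt_of_csInf_lt hne h1
  obtain ⟨z, hz, hxz⟩ := exists_lt_of_lt_csSup hne h2
  exact hJ.out hy hz ⟨hyx.le, hxz.le⟩

theorem mem_of_sInf_lt_of_not_bddAbove {J : Set ℝ} (hJ : J.OrdConnected) (hne : J.Nonempty) {x : ℝ}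
    (h1 : sInf J < x) (h2 : ¬ BddAbove J) : x ∈ J := by
  obtain ⟨y, hy, hyx⟩ := exists_lt_of_csInf_lt hne h1
  obtain ⟨z, hz, hxz⟩ := not_bddAbove_iff.1 h2 x
  exact hJ.out hy hz ⟨hyx.le, hxz.le⟩

theorem eventually_add_lt {x y : ℝ} (h : x < y) : ∀ᶠ ε in 𝓝[>] (0 : ℝ), x + ε < y := by
  filter_upwards [Ioo_mem_nhdsGT (sub_pos.2 h)] with ε hε
  linarith [hε.2]

/-- With the hypothesis inside the filter, a small `ε` can be fixed before it is known how `x` and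
`y` compare. -/
theorem eventually_add_lt_of_imp (x y : ℝ) : ∀ᶠ ε in 𝓝[>] (0 : ℝ), x < y → x + ε < y := by
  by_cases h : x < y
  · simpa [h] using eventually_add_lt h
  · simp [h]

open scoped Classical in
/-- The indicator of `s, t ∈ J`, which is the rank of the structure map of `𝕀_J` from `s` to `t`. -/
def intervalRank (J : Set ℝ) (s t : ℝ) : ℤ := if s ∈ J ∧ t ∈ J then 1 else 0

open scoped Classical in
theorem intervalRank_eq_ite {J : Set ℝ} {s t : ℝ} {q : Prop} (h : s ∈ J ∧ t ∈ J ↔ q) :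
    intervalRank J s t = if q then 1 else 0 := by
  simp only [intervalRank, h]

open scoped Classical in
-- With `a = inf J` and `c = sup J` finite, the right side is `([a ≤ b] - [a < b]) * ([d ≤ c] - [d <
-- c])` for small `ε`. If `J` is unbounded above, the terms at `d - ε` and `d + ε` cancel.
theorem eventually_intervalPoint_eq_coe {J : Set ℝ} (hJ : J.OrdConnected) (hne : J.Nonempty)
    (hb : BddBelow J) {b d : ℝ} (hbd : b < d) :
    ∀ᶠ ε in 𝓝[>] (0 : ℝ), (if ((b, (d : WithTop ℝ)) : ExtPlane) = intervalPoint J then 1 else 0 : ℤ) =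
      intervalRank J (b + ε) (d - ε) - intervalRank J (b - ε) (d - ε) -
        intervalRank J (b + ε) (d + ε) + intervalRank J (b - ε) (d + ε) := by
  set a := sInf J with ha
  have hlow : ∀ x ∈ J, a ≤ x := fun x hx => csInf_le hb hx
  have hpos : ∀ᶠ ε in 𝓝[>] (0 : ℝ), 0 < ε := eventually_mem_nhdsWithin
  by_cases hB : BddAbove J
  · set c := sSup J with hc
    have hup : ∀ x ∈ J, x ≤ c := fun x hx => le_csSup hB hx
    have hmem : ∀ x, a < x → x < c → x ∈ J := fun x => mem_of_sInf_lt_of_lt_sSup hJ hne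
    have hpt : ((b, (d : WithTop ℝ)) : ExtPlane) = intervalPoint J ↔ b = a ∧ d = c := by
      simp [intervalPoint, hB, ha, hc]
    -- The midpoint bound gives `b + ε < d - ε`.
    filter_upwards [hpos, eventually_add_lt (by linarith : b < (b + d) / 2),
      eventually_add_lt_of_imp b a, eventually_add_lt_of_imp a b,
      eventually_add_lt_of_imp c d, eventually_add_lt_of_imp d c] with ε h0 h1 h2 h3 h4 h5
    -- Membership in `J` implies weak inequalities with the endpoints and follows from strict ones.
    -- A condition `q` between the two decides the rank, whether or not `J` contains its endpoints.
    have key : ∀ s t, s ≤ t → ∀ q : Prop, (q → a < s ∧ t < c) → (a ≤ s → t ≤ c → q) →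
        intervalRank J s t = if q then 1 else 0 := fun s t hst q hq1 hq2 =>
      intervalRank_eq_ite ⟨fun h => hq2 (hlow _ h.1) (hup _ h.2), fun h =>
        ⟨hmem _ (hq1 h).1 (by linarith [(hq1 h).2]), hmem _ (by linarith [(hq1 h).1]) (hq1 h).2⟩⟩
    have low1 : a ≤ b + ε → a ≤ b := fun h => by by_contra h'; linarith [h2 (not_le.1 h')]
    have low2 : a < b → a < b - ε := fun h => by linarith [h3 h]
    have up1 : d - ε ≤ c → d ≤ c := fun h => by by_contra h'; linarith [h4 (not_le.1 h')]
    rw [key (b + ε) (d - ε) (by linarith) (a ≤ b ∧ d ≤ c)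
        (fun h => ⟨by linarith [h.1], by linarith [h.2]⟩) (fun h h' => ⟨low1 h, up1 h'⟩),
      key (b - ε) (d - ε) (by linarith) (a < b ∧ d ≤ c)
        (fun h => ⟨low2 h.1, by linarith [h.2]⟩) (fun h h' => ⟨by linarith, up1 h'⟩),
      key (b + ε) (d + ε) (by linarith) (a ≤ b ∧ d < c)
        (fun h => ⟨by linarith [h.1], h5 h.2⟩) (fun h h' => ⟨low1 h, by linarith⟩),
      key (b - ε) (d + ε) (by linarith) (a < b ∧ d < c)
        (fun h => ⟨low2 h.1, h5 h.2⟩) (fun h h' => ⟨by linarith, by linarith⟩)]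
    simp only [hpt]
    grind
  · have hpt : ((b, (d : WithTop ℝ)) : ExtPlane) ≠ intervalPoint J := by
      simp [intervalPoint, hB]
    have hmem : ∀ x, a < x → x ∈ J := fun x h => mem_of_sInf_lt_of_not_bddAbove hJ hne h hB
    filter_upwards [hpos, eventually_add_lt (by linarith : b < (b + d) / 2)] with ε h0 h1
    have key : ∀ s t t', s < t → s < t' → intervalRank J s t = intervalRank J s t' := by
      intro s t t' h h'
      have : (s ∈ J ∧ t ∈ J) ↔ (s ∈ J ∧ t' ∈ J) := and_congr_right fun hs =>
        ⟨fun _ => hmem _ ((hlow _ hs).trans_lt h'), fun _ => hmem _ ((hlow _ hs).trans_lt h)⟩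
      simp only [intervalRank, this]
    rw [if_neg hpt, key (b + ε) (d - ε) (d + ε) (by linarith) (by linarith),
      key (b - ε) (d - ε) (d + ε) (by linarith) (by linarith)]
    ring

open scoped Classical in
-- The parameter `ε⁻¹` acts as time infinity: it eventually leaves every bounded interval and stays
-- in every interval unbounded above.
theorem eventually_intervalPoint_eq_top {J : Set ℝ} (hJ : J.OrdConnected) (hne : J.Nonempty)
    (hb : BddBelow J) (b : ℝ) :
    ∀ᶠ ε in 𝓝[>] (0 : ℝ), (if ((b, (⊤ : WithTop ℝ)) : ExtPlane) = intervalPoint J then 1 else 0 : ℤ) =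
      intervalRank J (b + ε) ε⁻¹ - intervalRank J (b - ε) ε⁻¹ := by
  set a := sInf J with ha
  have hlow : ∀ x ∈ J, a ≤ x := fun x hx => csInf_le hb hx
  have hpos : ∀ᶠ ε in 𝓝[>] (0 : ℝ), 0 < ε := eventually_mem_nhdsWithin
  by_cases hB : BddAbove J
  · have hpt : ((b, (⊤ : WithTop ℝ)) : ExtPlane) ≠ intervalPoint J := by
      simp [intervalPoint, hB]
    filter_upwards [tendsto_inv_nhdsGT_zero.eventually_gt_atTop (sSup J)] with ε hε
    have : ε⁻¹ ∉ J := fun h => hε.not_ge (le_csSup hB h)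
    simp [intervalRank, this, hpt]
  · have hmem : ∀ x, a < x → x ∈ J := fun x h => mem_of_sInf_lt_of_not_bddAbove hJ hne h hB
    have hpt : ((b, (⊤ : WithTop ℝ)) : ExtPlane) = intervalPoint J ↔ b = a := by
      simp [intervalPoint, hB, ha]
    filter_upwards [hpos, tendsto_inv_nhdsGT_zero.eventually_gt_atTop a,
      eventually_add_lt_of_imp b a, eventually_add_lt_of_imp a b] with ε h0 h1 h2 h3
    have e1 : intervalRank J (b + ε) ε⁻¹ = if a ≤ b then 1 else 0 :=
      intervalRank_eq_ite ⟨fun h => by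
        by_contra h'; linarith [h2 (not_le.1 h'), hlow _ h.1], fun h =>
        ⟨hmem _ (by linarith), hmem _ h1⟩⟩
    have e2 : intervalRank J (b - ε) ε⁻¹ = if a < b then 1 else 0 :=
      intervalRank_eq_ite ⟨fun h => by linarith [hlow _ h.1], fun h =>
        ⟨hmem _ (by linarith [h3 h]), hmem _ h1⟩⟩
    rw [e1, e2]
    simp only [hpt]
    grind

theorem not_intervalPoint_eq_coe_of_lt {J : Set ℝ} (hne : J.Nonempty) (hb : BddBelow J) {b d : ℝ}
    (h : d < b) : ((b, (d : WithTop ℝ)) : ExtPlane) ≠ intervalPoint J := by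
  intro he
  by_cases hB : BddAbove J
  · have h2 : b = sInf J ∧ d = sSup J := by simpa [intervalPoint, hB] using he
    have := csInf_le_csSup hne hb hB
    linarith [h2.1, h2.2]
  · simp [intervalPoint, hB] at he

/-! ### Uniqueness of barcodes -/

theorem count_univ_map {N : ℕ} {α : Type*} [DecidableEq α] (f : Fin N → α) (x : α) :
    (((Finset.univ : Finset (Fin N)).val.map f).count x : ℤ) = ∑ i, if x = f i then 1 else 0 := by
  rw [Multiset.count_map, ← Finset.filter_val, Finset.card_val, Finset.card_filter]
  push_cast
  rfl

open scoped Classical in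
-- On the diagonal both multiplicities are already `⊤`.
theorem addDiagonal_eq_iff {B B' : Multiset ExtPlane} :
    addDiagonal B = addDiagonal B' ↔
      ∀ x : ExtPlane, x.2 ≠ (x.1 : WithTop ℝ) → B.count x = B'.count x := by
  constructor
  · intro h x hx
    simpa [addDiagonal, hx] using congrFun h x
  · intro h
    funext x
    by_cases hx : x.2 = (x.1 : WithTop ℝ)
    · simp [addDiagonal, hx]
    · simp [addDiagonal, hx, h x hx]

open scoped Classical in
theorem Bar.mk_eq_mk_iff {B B' : Multiset ExtPlane} :
    Bar.mk B = Bar.mk B' ↔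
      ∀ x : ExtPlane, x.2 ≠ (x.1 : WithTop ℝ) → B.count x = B'.count x :=
  Subtype.ext_iff.trans addDiagonal_eq_iff

/-- There are finitely many intervals, so a single `ε` serves all of them, and summing the indicator
formulas expresses each off-diagonal multiplicity through ranks. Points below the diagonal never
occur. -/
theorem mk_intervalPoint_eq_of_rank_eq {N N' : ℕ} {J : Fin N → Set ℝ} {J' : Fin N' → Set ℝ}
    (hJ : ∀ i, (J i).OrdConnected) (hne : ∀ i, (J i).Nonempty) (hb : ∀ i, BddBelow (J i))
    (hJ' : ∀ i, (J' i).OrdConnected) (hne' : ∀ i, (J' i).Nonempty) (hb' : ∀ i, BddBelow (J' i))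
    (hr : ∀ s t, s ≤ t → ∑ i, intervalRank (J i) s t = ∑ i, intervalRank (J' i) s t) :
    Bar.mk ((Finset.univ : Finset (Fin N)).val.map fun i => intervalPoint (J i)) =
      Bar.mk ((Finset.univ : Finset (Fin N')).val.map fun i => intervalPoint (J' i)) := by
  classical
  rw [Bar.mk_eq_mk_iff]
  rintro ⟨b, d⟩ hbd
  zify
  rw [count_univ_map, count_univ_map]
  have hpos : ∀ᶠ ε in 𝓝[>] (0 : ℝ), 0 < ε := eventually_mem_nhdsWithin
  induction d using WithTop.recTopCoe with
  | top =>
    -- The bounds `ε < 1` and `b + 1 < ε⁻¹` ensure `b + ε ≤ ε⁻¹`, as the rank hypothesis requires.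
    obtain ⟨ε, ⟨h0, h1, h2⟩, h, h'⟩ := ((hpos.and
      ((tendsto_inv_nhdsGT_zero.eventually_gt_atTop (b + 1)).and
        (eventually_add_lt (zero_lt_one (α := ℝ))))).and
      ((Filter.eventually_all.2 fun i => eventually_intervalPoint_eq_top (hJ i) (hne i) (hb i) b).and
      (Filter.eventually_all.2 fun i =>
        eventually_intervalPoint_eq_top (hJ' i) (hne' i) (hb' i) b))).exists
    rw [Finset.sum_congr rfl fun i _ => h i, Finset.sum_congr rfl fun i _ => h' i,
      Finset.sum_sub_distrib, Finset.sum_sub_distrib, hr _ _ (by linarith), hr _ _ (by linarith)]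
  | coe d =>
    have hbd' : d ≠ b := fun h => hbd (by simp [h])
    rcases hbd'.lt_or_gt with hlt | hlt
    · rw [Finset.sum_eq_zero fun i _ => if_neg (not_intervalPoint_eq_coe_of_lt (hne i) (hb i) hlt),
        Finset.sum_eq_zero fun i _ => if_neg (not_intervalPoint_eq_coe_of_lt (hne' i) (hb' i) hlt)]
    · obtain ⟨ε, ⟨h0, h1⟩, h, h'⟩ := ((hpos.and
        (eventually_add_lt (by linarith : b < (b + d) / 2))).and
        ((Filter.eventually_all.2 fun i =>
          eventually_intervalPoint_eq_coe (hJ i) (hne i) (hb i) hlt).and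
        (Filter.eventually_all.2 fun i =>
          eventually_intervalPoint_eq_coe (hJ' i) (hne' i) (hb' i) hlt))).exists
      rw [Finset.sum_congr rfl fun i _ => h i, Finset.sum_congr rfl fun i _ => h' i]
      simp only [Finset.sum_add_distrib, Finset.sum_sub_distrib]
      rw [hr _ _ (by linarith), hr _ _ (by linarith), hr _ _ (by linarith), hr _ _ (by linarith)]

variable {k}

theorem HasBarcode.unique {W : PersistenceModule.{u} k} {D D' : Bar} (h : HasBarcode.{u} k W D)
    (h' : HasBarcode.{u} k W D') : D = D' := by
  classical
  obtain ⟨N, J, hJ, hne, hb, ⟨e⟩, rfl⟩ := h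
  obtain ⟨N', J', hJ', hne', hb', ⟨e'⟩, rfl⟩ := h'
  refine mk_intervalPoint_eq_of_rank_eq hJ hne hb hJ' hne' hb' fun s t hst => ?_
  have := persistentRank_congr ((e ≪≫ sigmaIsoIntervalSum k J hJ).symm ≪≫
    (e' ≪≫ sigmaIsoIntervalSum k J' hJ')) hst
  rw [persistentRank_intervalSum, persistentRank_intervalSum] at this
  simp only [intervalRank]
  exact_mod_cast this

theorem HasBarcode.barcodeOf_eq {W : PersistenceModule.{u} k} {D : Bar}
    (h : HasBarcode.{u} k W D) : barcodeOf.{u} k W = D := by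
  have hex : ∃ D, HasBarcode.{u} k W D := ⟨D, h⟩
  rw [barcodeOf, dif_pos hex]
  exact hex.choose_spec.unique h

/-! ### Reparametrization -/

/-- The action of an order automorphism of `ℝ` on the extended plane. -/
def extPlaneMap (ψ : ℝ ≃o ℝ) (x : ExtPlane) : ExtPlane := (ψ x.1, x.2.map ψ)

theorem extPlaneMap_symm_apply (ψ : ℝ ≃o ℝ) (x : ExtPlane) :
    extPlaneMap ψ (extPlaneMap ψ.symm x) = x := by
  obtain ⟨b, d⟩ := x
  induction d using WithTop.recTopCoe <;> simp [extPlaneMap]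

theorem extPlaneMap_injective (ψ : ℝ ≃o ℝ) : Function.Injective (extPlaneMap ψ) :=
  Function.LeftInverse.injective (g := extPlaneMap ψ.symm) (extPlaneMap_symm_apply ψ.symm)

theorem extPlaneMap_diagonal_iff (ψ : ℝ ≃o ℝ) (x : ExtPlane) :
    (extPlaneMap ψ x).2 = ((extPlaneMap ψ x).1 : WithTop ℝ) ↔ x.2 = (x.1 : WithTop ℝ) := by
  obtain ⟨b, d⟩ := x
  induction d using WithTop.recTopCoe <;> simp [extPlaneMap]

/-- Equal barcodes may come from different multisets. The action of `ψ` still descends, being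
injective and preserving the diagonal and its complement. -/
theorem Bar.mk_map_extPlaneMap (ψ : ℝ ≃o ℝ) {B B' : Multiset ExtPlane} (h : Bar.mk B = Bar.mk B') :
    Bar.mk (B.map (extPlaneMap ψ)) = Bar.mk (B'.map (extPlaneMap ψ)) := by
  classical
  rw [Bar.mk_eq_mk_iff] at h ⊢
  intro x hx
  rw [← extPlaneMap_symm_apply ψ x] at hx ⊢
  rw [Multiset.count_map_eq_count' _ _ (extPlaneMap_injective ψ),
    Multiset.count_map_eq_count' _ _ (extPlaneMap_injective ψ)]
  exact h _ fun h' => hx ((extPlaneMap_diagonal_iff ψ _).2 h')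

theorem intervalPoint_preimage_symm (ψ : ℝ ≃o ℝ) {J : Set ℝ} (hne : J.Nonempty)
    (hb : BddBelow J) : intervalPoint (ψ.symm ⁻¹' J) = extPlaneMap ψ (intervalPoint J) := by
  have himg : ψ.symm ⁻¹' J = ψ '' J := (ψ.toEquiv.image_eq_preimage_symm J).symm
  have hB : BddAbove (ψ '' J) ↔ BddAbove J := ψ.bddAbove_image
  rw [himg]
  refine Prod.ext (ψ.map_csInf' hne hb).symm ?_
  by_cases h : BddAbove J
  · simp [intervalPoint, extPlaneMap, hB, h, ψ.map_csSup' hne h]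
  · simp [intervalPoint, extPlaneMap, hB, h]

theorem HasBarcode.reparametrize {W W' : PersistenceModule.{u} k} (ψ : ℝ ≃o ℝ)
    (e : W' ≅ ψ.symm.monotone.functor ⋙ W) {D : Bar} (h : HasBarcode.{u} k W D) :
    ∃ B, D = Bar.mk B ∧ HasBarcode.{u} k W' (Bar.mk (B.map (extPlaneMap ψ))) := by
  obtain ⟨N, J, hJ, hne, hb, ⟨i⟩, rfl⟩ := h
  have hJ' : ∀ i, (ψ.symm ⁻¹' J i).OrdConnected := fun i =>
    (hJ i).preimage_mono ψ.symm.monotone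
  refine ⟨_, rfl, N, fun i => ψ.symm ⁻¹' J i, hJ', fun i => (hne i).preimage ψ.symm.surjective,
    fun i => ?_, ⟨?_⟩, ?_⟩
  · exact ψ.symm.bddBelow_preimage.2 (hb i)
  -- In the explicit model, the spaces of the pulled back sum and of the sum of the preimages
  -- coincide by definition at each `t`, so identities serve as components.
  · exact e ≪≫ Functor.isoWhiskerLeft _ (i ≪≫ sigmaIsoIntervalSum k J hJ) ≪≫
      (NatIso.ofComponents (fun t => Iso.refl _) :
        ψ.symm.monotone.functor ⋙ intervalSum.{u} k J hJ ≅ intervalSum.{u} k _ hJ') ≪≫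
      (sigmaIsoIntervalSum k _ hJ').symm
  · rw [Multiset.map_map]
    congr 1
    exact Multiset.map_congr rfl fun i _ => (intervalPoint_preimage_symm ψ (hne i) (hb i)).symm

theorem sublevelComplex_eq_of_orderIso {V : Type u} {K : PreAbstractSimplicialComplex V}
    {f g : K → ℝ} (hf : IsFilterFunction f) (hg : IsFilterFunction g) (ψ : ℝ ≃o ℝ)
    (hψ : ∀ σ, ψ (f σ) = g σ) (t : ℝ) :
    sublevelComplex g hg t = sublevelComplex f hf (ψ.symm t) := by
  refine SetLike.ext fun σ => exists_congr fun h => ?_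
  rw [← hψ, ← ψ.le_symm_apply]

/-- Composing a filter function with an order automorphism of `ℝ` reparametrizes its persistent
homology. -/
def persistentHomologyReparametrize (p : ℕ) {V : Type u} [Fintype V]
    {K : PreAbstractSimplicialComplex V} {f g : K → ℝ} (hf : IsFilterFunction f)
    (hg : IsFilterFunction g) (ψ : ℝ ≃o ℝ) (hψ : ∀ σ, ψ (f σ) = g σ) :
    persistentHomology k p g hg ≅ ψ.symm.monotone.functor ⋙ persistentHomology k p f hf :=
  -- The isomorphism is built in the poset of complexes, where naturality is automatic, and then
  -- pushed through realization and homology.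
  Functor.isoWhiskerRight
    (NatIso.ofComponents
      (fun t => eqToIso (sublevelComplex_eq_of_orderIso hf hg ψ hψ t))
      (fun _ => Subsingleton.elim _ _) :
      (sublevelComplex_mono g hg).functor ≅
        ψ.symm.monotone.functor ⋙ (sublevelComplex_mono f hf).functor)
    (realizationFunctor V ⋙ singularHomologyOver k p)

theorem Dgm_eq_mk_map_of_orderIso (p : ℕ) {V : Type u} [Fintype V]
    {K : PreAbstractSimplicialComplex V} {f g : K → ℝ} (hf : IsFilterFunction f)
    (hg : IsFilterFunction g) (ψ : ℝ ≃o ℝ) (hψ : ∀ σ, ψ (f σ) = g σ) {B : Multiset ExtPlane}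
    (hB : Dgm k p f hf = Bar.mk B) : Dgm k p g hg = Bar.mk (B.map (extPlaneMap ψ)) := by
  by_cases hex : ∃ D, HasBarcode.{u} k (persistentHomology k p f hf) D
  · obtain ⟨D, hD⟩ := hex
    obtain ⟨B', rfl, hB'⟩ := hD.reparametrize ψ (persistentHomologyReparametrize p hf hg ψ hψ)
    rw [Dgm, hD.barcodeOf_eq] at hB
    rw [Dgm, hB'.barcodeOf_eq, Bar.mk_map_extPlaneMap ψ hB]
  -- Existence of barcodes is not needed: using `ψ.symm`, if `f` has none then neither does `g`, and
  -- the default `Bar.mk 0` is fixed by `ψ`.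
  · have hex' : ¬ ∃ D, HasBarcode.{u} k (persistentHomology k p g hg) D := by
      rintro ⟨D, hD⟩
      obtain ⟨B', -, hB'⟩ := hD.reparametrize ψ.symm
        (persistentHomologyReparametrize p hg hf ψ.symm fun σ => by simp [← hψ])
      exact hex ⟨_, hB'⟩
    rw [Dgm, barcodeOf, dif_neg hex] at hB
    rw [Dgm, barcodeOf, dif_neg hex', ← Bar.mk_map_extPlaneMap ψ hB, Multiset.map_zero]

/-- Barcode templates only depend on the ordering equivalence class of a filter function. -/
theorem IsBarcodeTemplate.of_orderingEquivalent {p : ℕ} {V : Type u} [Fintype V]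
    {K : PreAbstractSimplicialComplex V} {f g : K → ℝ} {hf : IsFilterFunction f}
    (hg : IsFilterFunction g) (hfg : OrderingEquivalent f g) {P : Multiset (K × K)}
    {T : Multiset K} (h : IsBarcodeTemplate k p f hf P T) : IsBarcodeTemplate k p g hg P T := by
  obtain ⟨ψ, hψ⟩ := hfg.exists_orderIso
  rw [IsBarcodeTemplate, Dgm_eq_mk_map_of_orderIso p hf hg ψ hψ h, Multiset.map_add,
    Multiset.map_map, Multiset.map_map]
  simp [Function.comp_def, extPlaneMap, hψ]

/-! ### The lift -/

theorem barQuotient_readSimplices {V : Type u} {K : PreAbstractSimplicialComplex V} {m n : ℕ}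
    (σ σ' : Fin m → K) (τ : Fin n → K) (f : K → ℝ) :
    barQuotient m n (readSimplices σ σ' τ f) =
      Bar.mk (((Finset.univ : Finset (Fin m)).val.map fun i => (σ i, σ' i)).map
          (fun q => (f q.1, (f q.2 : WithTop ℝ))) +
        ((Finset.univ : Finset (Fin n)).val.map τ).map (fun τ => (f τ, (⊤ : WithTop ℝ)))) := by
  rw [Multiset.map_map, Multiset.map_map]
  simp [barQuotient, readSimplices]

/-- `readSimplices` as a continuous linear map. -/
def readSimplicesCLM {V : Type u} [Fintype V] {K : PreAbstractSimplicialComplex V} {m n : ℕ}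
    (σ σ' : Fin m → K) (τ : Fin n → K) : EuclideanSpace ℝ K →L[ℝ] OrderedBarcode m n :=
  LinearMap.toContinuousLinearMap
    { toFun := fun f => readSimplices σ σ' τ f
      map_add' := fun f g => by
        ext (⟨i, j⟩ | j) <;> simp [readSimplices]
        split_ifs <;> rfl
      map_smul' := fun c f => by
        ext (⟨i, j⟩ | j) <;> simp [readSimplices] }

end

/-! ### The differential formula -/

theorem mainTheorem4
    (k : Type v) [Field k] (p : ℕ)
    {V : Type u} [Fintype V] (K : PreAbstractSimplicialComplex V)
    {E : Type*} [NormedAddCommGroup E] [NormedSpace ℝ E] [FiniteDimensional ℝ E]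
    {H : Type*} [TopologicalSpace H] (I : ModelWithCorners ℝ E H)
    {M : Type*} [TopologicalSpace M] [ChartedSpace H M] [IsManifold I ∞ M]
    [BoundarylessManifold I M]
    (F : M → EuclideanSpace ℝ K) (hF : ∀ θ, IsFilterFunction (F θ)) (hFcont : Continuous F)
    (U : Set M) (hU : IsOpen U) (hFU : ContMDiffOn I 𝓘(ℝ, EuclideanSpace ℝ K) 1 F U)
    (θ : M) (hθ : θ ∈ U ∩ orderStableSet F)
    (P : Multiset (K × K)) (T : Multiset K) (hPT : IsBarcodeTemplate k p (F θ) (hF θ) P T)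
    (m n : ℕ) (σ σ' : Fin m → K) (τ : Fin n → K)
    (hP : (Finset.univ : Finset (Fin m)).val.map (fun i => (σ i, σ' i)) = P)
    (hT : (Finset.univ : Finset (Fin n)).val.map τ = T) :
    ∃ h : IsLocalLift I 1 (barcodeMap k p F hF) θ (fun θ' => readSimplices σ σ' τ (F θ')),
      ∀ w : TangentSpace I θ,
        barcodeDifferential I h w =
          readSimplices σ σ' τ (parametrizationDifferential I F θ w) := by
  obtain ⟨hθU, O, hO, hθO, hequiv⟩ := hθ
  refine ⟨⟨U ∩ O, hU.inter hO, ⟨hθU, hθO⟩, ?_, fun x hx => ?_⟩, fun w => ?_⟩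
  · exact (readSimplicesCLM σ σ' τ).contMDiff.comp_contMDiffOn (hFU.mono Set.inter_subset_left)
  · rw [barQuotient_readSimplices, hP, hT]
    exact hPT.of_orderingEquivalent (hF x) fun a b => (hequiv x hx.2 a b).symm
  · have hFd : MDifferentiableAt I 𝓘(ℝ, EuclideanSpace ℝ K) F θ :=
      (hFU.contMDiffAt (hU.mem_nhds hθU)).mdifferentiableAt one_ne_zero
    -- Chain rule, the outer map being linear and thus its own derivative.
    have hc := mfderiv_comp (I := I) (I' := 𝓘(ℝ, EuclideanSpace ℝ K))
      (I'' := 𝓘(ℝ, OrderedBarcode m n)) θ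
      (readSimplicesCLM σ σ' τ).differentiableAt.mdifferentiableAt hFd
    rw [mfderiv_eq_fderiv, ContinuousLinearMap.fderiv] at hc
    exact congrArg (fun L => L w) hc
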